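/- Let $(\Delta,\mathcal F,\mathbb P)$ be a probability space with $\Delta\subseteq\mathbb R^m$ (for instance with the Borel $\sigma$-algebra of $\Delta$), and let $g:\mathbb R^n\times\mathbb R^m\to\mathbb R$ be such that $x\mapsto g(x,\delta)$ is convex and lower semicontinuous for every $\delta\in\Delta$, and $\delta\mapsto g(x,\delta)$ is measurable on $\Delta$ for every $x\in\mathbb R^n$. For $S\subseteq\mathbb R^n$ define the probability of violation $$V(S):=\sup_{x\in S}\mathbb P\left(\{\delta\in\Delta\mid g(x,\delta)>0\}\right),\qquad V(\varnothing):=0.$$ A set-valued mapping $X:\Delta^N\rightrightarrows\mathbb R^n$ is called measurable if $\{\omega\mid X(\omega)\cap O\neq\varnothing\}$ is measurable (for the product $\sigma$-algebra) for every open $O\subseteq\mathbb R^n$. A set is universally measurable if it belongs to the completion of the $\sigma$-algebra with respect to every finite measure; a function is universally measurable if preimages of Borel sets are universally measurable. 1. For every $x\in\mathbb R^n$, the set $\{\delta\in\Delta\mid g(x,\delta)\le 0\}$ is measurable, so that the probability $\mathbb P(\{\delta\in\Delta\mid g(x,\delta)\le 0\})$ is well defined. 2. For every $N$ and every measurable set-valued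 mapping $X:\Delta^N\rightrightarrows\mathbb R^n$, the function $\omega\mapsto\sup_{x\in X(\omega)}V(\{x\})$ is universally measurable. Moreover, for every $\epsilon\in(0,1)$, the set $\{\omega\in\Delta^N\mid V(X(\omega))>\epsilon\}$ is universally measurable and, in particular, belongs to the completion of the product $\sigma$-algebra with respect to $\mathbb P^N$; that is, the probability $\mathbb P^N(\{\omega\in\Delta^N\mid V(X(\omega))>\epsilon\})$ is nearly well defined. -/

import Mathlib

open MeasureTheory

/-- A set is universally measurable if it belongs to the completion of the σ-algebra with respect
to every finite measure. -/
def UniversallyMeasurableSet {α : Type*} [MeasurableSpace α] (s : Set α) : Prop :=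
  ∀ μ : Measure α, IsFiniteMeasure μ → NullMeasurableSet s μ

/-- A function is universally measurable if preimages of measurable sets are universally
measurable. -/
def UniversallyMeasurable {α β : Type*} [MeasurableSpace α] [MeasurableSpace β]
    (f : α → β) : Prop :=
  ∀ B : Set β, MeasurableSet B → UniversallyMeasurableSet (f ⁻¹' B)

/-- A set-valued mapping `M` (with arbitrary, possibly empty or non-closed, values) is measurable
if `{v | M v ∩ O ≠ ∅}` is measurable for each open set `O`. -/
def MeasurableSetValued {α β : Type*} [MeasurableSpace α] [TopologicalSpace β]
    (M : α → Set β) : Prop :=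
  ∀ O : Set β, IsOpen O → MeasurableSet {v | (M v ∩ O).Nonempty}

/-- The probability of violation of a set `S`: `V(S) = sup_{x ∈ S} ℙ {δ ∈ Δ | g(x, δ) > 0}`
(equal to `0` when `S` is empty). -/
noncomputable def violationProbability {n m : ℕ} {Δ : Set (EuclideanSpace ℝ (Fin m))}
    {F : MeasurableSpace Δ} (P : Measure Δ)
    (g : EuclideanSpace ℝ (Fin n) → EuclideanSpace ℝ (Fin m) → ℝ)
    (S : Set (EuclideanSpace ℝ (Fin n))) : ENNReal :=
  ⨆ x ∈ S, P {δ : Δ | 0 < g x δ}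

/-! Lower semicontinuity of `x ↦ V({x})` makes each `{x | c < V({x})}` open. A supremum over `X ω`
exceeds `c` exactly when `X ω` meets this open set, an event that is measurable by the definition of
a measurable `X`. The sets in part 2 are thus truly measurable, hence universally measurable. -/

/-- If `g` is lower semicontinuous in `x`, then so is `x ↦ V({x})`: this is Fatou's lemma for the
sets `{δ | 0 < g (u k) δ}` along a convergent sequence `u`. -/
theorem isOpen_lt_violationProbability_singleton {n m : ℕ}
    {Δ : Set (EuclideanSpace ℝ (Fin m))} {F : MeasurableSpace Δ} (P : Measure Δ)
    {g : EuclideanSpace ℝ (Fin n) → EuclideanSpace ℝ (Fin m) → ℝ}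
    (hlsc : ∀ δ ∈ Δ, LowerSemicontinuous (fun x => g x δ)) (c : ENNReal) :
    IsOpen {x | c < violationProbability P g {x}} := by
  simp only [violationProbability, Set.mem_singleton_iff, iSup_iSup_eq_left]
  rw [← isClosed_compl_iff]
  refine IsSeqClosed.isClosed fun u x hu hx => ?_
  simp only [Set.mem_compl_iff, Set.mem_ofPred_eq, not_lt] at hu ⊢
  have hmono : Monotone fun k => ⋂ j ≥ k, {δ : Δ | 0 < g (u j) δ} := fun a b hab =>
    Set.biInter_subset_biInter_left fun j hj => le_trans hab hj
  calc P {δ : Δ | 0 < g x δ} ≤ P (⋃ k, ⋂ j ≥ k, {δ : Δ | 0 < g (u j) δ}) := by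
        refine measure_mono fun δ hδ => ?_
        obtain ⟨k, hk⟩ := Filter.eventually_atTop.1 (hx.eventually (hlsc δ δ.2 x 0 hδ))
        exact Set.mem_iUnion.2 ⟨k, Set.mem_iInter₂.2 hk⟩
    -- Continuity from below along an increasing sequence needs no measurability of the sets.
    _ = ⨆ k, P (⋂ j ≥ k, {δ : Δ | 0 < g (u j) δ}) := hmono.measure_iUnion
    _ ≤ c := iSup_le fun k => (measure_mono (Set.iInter₂_subset k le_rfl)).trans (hu k)

theorem mainTheorem10 {n m : ℕ}
    -- the probability space `(Δ, F, P)` with `Δ ⊆ ℝᵐ`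
    (Δ : Set (EuclideanSpace ℝ (Fin m))) (F : MeasurableSpace Δ)
    (P : Measure Δ) (hP : IsProbabilityMeasure P)
    (g : EuclideanSpace ℝ (Fin n) → EuclideanSpace ℝ (Fin m) → ℝ)
    (hconv : ∀ δ ∈ Δ, ConvexOn ℝ Set.univ (fun x => g x δ))
    (hlsc : ∀ δ ∈ Δ, LowerSemicontinuous (fun x => g x δ))
    (hmeas : ∀ x, Measurable (fun δ : Δ => g x δ)) :
    (∀ x, MeasurableSet {δ : Δ | g x δ ≤ 0}) ∧
    ∀ (N : ℕ) (X : (Fin N → Δ) → Set (EuclideanSpace ℝ (Fin n))), MeasurableSetValued X →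
      UniversallyMeasurable (fun ω => ⨆ x ∈ X ω, violationProbability P g {x}) ∧
      ∀ ε : ℝ, 0 < ε → ε < 1 →
        UniversallyMeasurableSet {ω | ENNReal.ofReal ε < violationProbability P g (X ω)} ∧
        NullMeasurableSet {ω | ENNReal.ofReal ε < violationProbability P g (X ω)}
          (Measure.pi (fun _ : Fin N => P)) := by
  refine ⟨fun x => measurableSet_le (hmeas x) measurable_const, fun N X hX => ?_⟩
  have hopen : ∀ c, IsOpen {x | c < violationProbability P g {x}} := fun c =>
    isOpen_lt_violationProbability_singleton P hlsc c
  have hsup : ∀ (c : ENNReal), MeasurableSet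
      {ω | c < ⨆ x ∈ X ω, violationProbability P g {x}} := by
    intro c
    -- The strict inequality yields a witness in `X ω` even if the supremum is not attained.
    convert hX _ (hopen c) using 1
    ext ω
    simp only [Set.mem_ofPred_eq, lt_iSup_iff, Set.Nonempty, Set.mem_inter_iff, exists_prop]
  have hset : ∀ c : ENNReal, MeasurableSet {ω | c < violationProbability P g (X ω)} := by
    intro c
    simpa only [violationProbability, Set.mem_singleton_iff, iSup_iSup_eq_left] using hsup c
  exact ⟨fun B hB μ _ => (measurable_of_Ioi hsup hB).nullMeasurableSet, fun ε _ _ =>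
    ⟨fun μ _ => (hset _).nullMeasurableSet, (hset _).nullMeasurableSet⟩⟩
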